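/- Let $\mathbb K$ be a field with more than $2$ elements, and let $U$ and $V$ be finite-dimensional vector spaces over $\mathbb K$. Denote by $\mathcal L(U,V)$ the space of all linear maps from $U$ to $V$. For a subset $\mathcal S\subseteq\mathcal L(U,V)$, a map $F:\mathcal S\to V$ is called range-compatible if $F(s)\in\operatorname{im} s$ for all $s\in\mathcal S$, and local if there is a vector $x\in U$ such that $F(s)=s(x)$ for all $s\in\mathcal S$. The codimension of a (nonempty) affine subspace of $\mathcal L(U,V)$ is the codimension of its translation vector space in $\mathcal L(U,V)$. (a) Let $\mathcal S$ be an affine subspace of $\mathcal L(U,V)$ with $\operatorname{codim}\mathcal S\le\dim V-1$. Then every range-compatible affine map $F:\mathcal S\to V$ is local. (b) The bound in (a) is optimal: if $\dim U\ge 2$ and $\dim V\ge 2$, then there exist an affine subspace $\mathcal S$ of $\mathcal L(U,V)$ with $\operatorname{codim}\mathcal S=\dim V$ and a range-compatible affine map $F:\mathcal S\to V$ that is not local. -/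

import Mathlib

section RangeCompatible

variable {K U V : Type*} [Field K] [AddCommGroup U] [Module K U] [AddCommGroup V] [Module K V]

/-- A map `F : 𝒮 → V` on a set `𝒮` of linear maps from `U` to `V` is range-compatible when
`F s` lies in the range of `s` for every `s ∈ 𝒮`. -/
def IsRangeCompatible {S : Set (U →ₗ[K] V)} (F : S → V) : Prop :=
  ∀ s : S, F s ∈ LinearMap.range (s : U →ₗ[K] V)

/-- A map `F : 𝒮 → V` on a set `𝒮` of linear maps from `U` to `V` is local when it is the
evaluation at some fixed vector `x ∈ U`. -/
def IsLocalMap {S : Set (U →ₗ[K] V)} (F : S → V) : Prop :=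
  ∃ x : U, ∀ s : S, F s = (s : U →ₗ[K] V) x

end RangeCompatible

/-- The codimension of a (nonempty) affine subspace of a vector space `E`: the dimension of the
quotient of `E` by the translation vector space. -/
noncomputable def affineCodim {K E : Type*} [Field K] [AddCommGroup E] [Module K E]
    (S : AffineSubspace K E) : ℕ :=
  Module.finrank K (E ⧸ S.direction)

/-! Write a map on `s₀ + D` as F(s₀ + d) = v₀ + f d, and regard `rowForm z u` as the tensor z ⊗ u;
the annihilator D^⊥ has dimension codim D < dim V. Call z degenerate if z ⊗ u ∈ D^⊥ for some u ≠ 0.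
Independent degenerate forms give independent tensors in D^⊥, so the degenerate forms all vanish at
some v ≠ 0. If z v = 1, the rows z ∘ d fill the dual of U, and range-compatibility makes z ∘ F an
evaluation; subtracting it leaves z ∘ F = 0.

Suppose then F ≠ 0. For h v = 0 every z + c h is nondegenerate. Comparing c = 1 with c = a, where a
∉ {0, 1}, gives a tensor h ⊗ q + z ⊗ p in D^⊥ that also kills `s₀`, with q ≠ 0 if h ∘ F ≠ 0. Such h
span v^⊥, so dim V - 1 of these tensors form a basis of D^⊥. Hence `s₀ ∈ D` and F is linear on D;
one more relation then puts in D^⊥ a rank-one tensor whose form is nonzero at v, a contradiction. -/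

/-! ### Row forms and degenerate linear forms -/

section RowFunctional

open Module

variable {K U V : Type*} [Field K] [AddCommGroup U] [Module K U] [AddCommGroup V] [Module K V]

/-- The linear form `s ↦ z (s u)` on `U →ₗ[K] V`. -/
def rowForm (z : Dual K V) (u : U) : Dual K (U →ₗ[K] V) :=
  z ∘ₗ LinearMap.applyₗ u

@[simp]
theorem rowForm_apply (z : Dual K V) (u : U) (s : U →ₗ[K] V) : rowForm z u s = z (s u) := rfl

/-- Linearly independent linear forms that vanish on `M` are at most `codim M` in number. -/
theorem card_le_finrank_quotient_of_linearIndependent {E ι : Type*} [AddCommGroup E] [Module K E]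
    [FiniteDimensional K E] [Fintype ι] {M : Submodule K E} {ε : ι → Dual K E}
    (hε : LinearIndependent K ε) (hM : ∀ i, ε i ∈ M.dualAnnihilator) :
    Fintype.card ι ≤ finrank K (E ⧸ M) := by
  have h : LinearIndependent K (fun i => (⟨ε i, hM i⟩ : M.dualAnnihilator)) :=
    LinearIndependent.of_comp M.dualAnnihilator.subtype hε
  refine h.fintype_card_le_finrank.trans (le_of_eq ?_)
  rw [← M.dualQuotEquivDualAnnihilator.finrank_eq, Subspace.dual_finrank_eq]

theorem eq_zero_of_sum_rowForm_eq_zero {ι : Type*} [Fintype ι] {h : ι → Dual K V}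
    (hh : LinearIndependent K h) {q : ι → U}
    (h0 : ∑ i, rowForm (h i) (q i) = 0) (i : ι) : q i = 0 := by
  rw [← forall_dual_apply_eq_zero_iff K]
  intro φ
  have key : ∑ j, φ (q j) • h j = 0 := by
    ext v
    have := LinearMap.congr_fun h0 (φ.smulRight v)
    simpa [LinearMap.sum_apply] using this
  exact Fintype.linearIndependent_iff.1 hh _ key i

/-- Testing on the rank-one maps u ↦ φ(u) v isolates p, because v kills every `h i` but not z. -/
theorem eq_zero_of_sum_rowForm_add_eq_zero {ι : Type*} [Fintype ι] {h : ι → Dual K V}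
    (hh : LinearIndependent K h) {z : Dual K V} {v : V} (hz : z v = 1) (hv : ∀ i, h i v = 0)
    {q : ι → U} {p : U} (h0 : ∑ i, rowForm (h i) (q i) + rowForm z p = 0) :
    p = 0 ∧ ∀ i, q i = 0 := by
  have hp : p = 0 := by
    rw [← forall_dual_apply_eq_zero_iff K]
    intro φ
    have := LinearMap.congr_fun h0 (φ.smulRight v)
    simpa [LinearMap.sum_apply, hv, hz] using this
  refine ⟨hp, eq_zero_of_sum_rowForm_eq_zero hh ?_⟩
  rw [← h0, hp]
  ext s
  simp

theorem linearIndependent_rowForm_add {ι : Type*} [Fintype ι] {h : ι → Dual K V}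
    (hh : LinearIndependent K h) {z : Dual K V} {v : V} (hz : z v = 1) (hv : ∀ i, h i v = 0)
    {q : ι → U} (p : ι → U) (hq : ∀ i, q i ≠ 0) :
    LinearIndependent K (fun i => rowForm (h i) (q i) + rowForm z (p i)) := by
  rw [Fintype.linearIndependent_iff]
  intro a ha i
  have := (eq_zero_of_sum_rowForm_add_eq_zero hh hz hv (q := fun i => a i • q i)
    (p := ∑ i, a i • p i) ?_).2 i
  · exact (smul_eq_zero.1 this).resolve_right (hq i)
  · rw [← ha]
    ext s
    simp [LinearMap.sum_apply, Finset.sum_add_distrib]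

/-- If `codim D < dim V`, the linear forms `z` for which some `u ≠ 0` makes `z (d u)` vanish on `D`
all vanish at a common nonzero vector. -/
theorem exists_ne_zero_forall_degenerate_apply_eq_zero [FiniteDimensional K U]
    [FiniteDimensional K V] {D : Submodule K (U →ₗ[K] V)}
    (hD : finrank K ((U →ₗ[K] V) ⧸ D) < finrank K V) :
    ∃ v : V, v ≠ 0 ∧ ∀ (z : Dual K V) (u : U), u ≠ 0 → (∀ d ∈ D, z (d u) = 0) → z v = 0 := by
  set s : Set (Dual K V) := {z | ∃ u : U, u ≠ 0 ∧ ∀ d ∈ D, z (d u) = 0} with hs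
  -- Otherwise a basis of degenerate forms would yield dim V independent tensors in D^⊥.
  have hlt : Submodule.span K s ≠ ⊤ := by
    intro htop
    obtain ⟨b, hbs, -, hspan, hb⟩ := exists_linearIndepOn_id_extension
      (linearIndepOn_empty K (id : Dual K V → Dual K V)) (Set.empty_subset s)
    have hb' : LinearIndependent K (fun x : b => (x : Dual K V)) := hb
    have hbtop : Submodule.span K b = ⊤ := by
      rw [eq_top_iff, ← htop]
      exact Submodule.span_le.2 hspan
    have : Fintype b := (hb'.setFinite).fintype
    choose u hu hu0 using fun z : b => hbs z.2
    have hind : LinearIndependent K (fun z : b => rowForm (z : Dual K V) (u z)) := by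
      rw [Fintype.linearIndependent_iff]
      intro a ha i
      have := eq_zero_of_sum_rowForm_eq_zero hb' (q := fun i => a i • u i) (by
        rw [← ha]; ext s; simp [LinearMap.sum_apply]) i
      exact (smul_eq_zero.1 this).resolve_right (hu i)
    have hcard := card_le_finrank_quotient_of_linearIndependent hind (M := D)
      (fun z => (Submodule.mem_dualAnnihilator _).2 fun d hd => hu0 z d hd)
    have h2 : finrank K (Dual K V) = Fintype.card b := by
      rw [← finrank_top, ← hbtop]
      rw [← finrank_span_eq_card hb', Subtype.range_coe]
    rw [Subspace.dual_finrank_eq] at h2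
    omega
  obtain ⟨g, hg, hle⟩ := Submodule.exists_le_ker_of_lt_top _ (lt_top_iff_ne_top.2 hlt)
  refine ⟨(evalEquiv K V).symm g, by simpa using hg, fun z u hu hz => ?_⟩
  have : g z = 0 := hle (Submodule.subset_span ⟨u, hu, hz⟩)
  rw [← this]
  conv_rhs => rw [← (evalEquiv K V).apply_symm_apply g]
  rfl

/-- A linear form on a space of operators that vanishes wherever the row `z ∘ d` does is an
evaluation of that row. -/
theorem exists_forall_eq_row_apply [FiniteDimensional K U] {D : Submodule K (U →ₗ[K] V)}
    (z : Dual K V) (g : Dual K D)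
    (hg : ∀ d : D, z ∘ₗ (d : U →ₗ[K] V) = 0 → g d = 0) :
    ∃ x : U, ∀ d : D, g d = z ((d : U →ₗ[K] V) x) := by
  let Φ : D →ₗ[K] Dual K U := (LinearMap.compRight K z) ∘ₗ D.subtype
  have hmem : g ∈ Φ.ker.dualAnnihilator := by
    rw [Submodule.mem_dualAnnihilator]
    exact fun d hd => hg d hd
  rw [← LinearMap.range_dualMap_eq_dualAnnihilator_ker] at hmem
  obtain ⟨L, hL⟩ := hmem
  refine ⟨(evalEquiv K U).symm L, fun d => ?_⟩
  rw [← hL]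
  change L (Φ d) = Φ d ((evalEquiv K U).symm L)
  conv_lhs => rw [← (evalEquiv K U).apply_symm_apply L]
  rfl

/-- A functional on the dual of U that kills all rows z ∘ d is evaluation at some u, and
nondegeneracy forces u = 0. -/
theorem exists_row_comp_eq_of_nondegenerate [FiniteDimensional K U] {D : Submodule K (U →ₗ[K] V)}
    {z : Dual K V} (hz : ∀ u : U, (∀ d ∈ D, z (d u) = 0) → u = 0) (φ : Dual K U) :
    ∃ d ∈ D, z ∘ₗ d = φ := by
  let Φ : D →ₗ[K] Dual K U := (LinearMap.compRight K z) ∘ₗ D.subtype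
  have htop : LinearMap.range Φ = ⊤ := by
    by_contra hne
    obtain ⟨g, hg, hle⟩ := Submodule.exists_le_ker_of_lt_top _ (lt_top_iff_ne_top.2 hne)
    apply hg
    have h0 : (evalEquiv K U).symm g = 0 := by
      refine hz _ fun d hd => ?_
      have h1 : g (Φ ⟨d, hd⟩) = 0 := hle ⟨⟨d, hd⟩, rfl⟩
      rw [← h1]
      conv_rhs => rw [← (evalEquiv K U).apply_symm_apply g]
      rfl
    simpa using h0
  obtain ⟨d, hd⟩ := LinearMap.range_eq_top.1 htop φ
  exact ⟨d, d.2, hd⟩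

/-- At a nondegenerate linear form `z`, an affine range-compatible map is an evaluation. -/
theorem exists_row_eq_of_nondegenerate [FiniteDimensional K U] {D : Submodule K (U →ₗ[K] V)}
    {s₀ : U →ₗ[K] V} {f : D →ₗ[K] V} {v₀ : V}
    (hF : ∀ d : D, v₀ + f d ∈ LinearMap.range (s₀ + (d : U →ₗ[K] V)))
    {z : Dual K V} (hz : ∀ u : U, (∀ d ∈ D, z (d u) = 0) → u = 0) :
    ∃ x : U, z v₀ = z (s₀ x) ∧ ∀ d : D, z (f d) = z ((d : U →ₗ[K] V) x) := by
  -- Move the base point to s₀ + d₁, whose z-row is zero: there z ∘ F vanishes, so it becomes linear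
  -- in the row.
  obtain ⟨d₁, hd₁, h₁⟩ := exists_row_comp_eq_of_nondegenerate hz (-(z ∘ₗ s₀))
  have hrow (d : D) (hd : z ∘ₗ (d : U →ₗ[K] V) = 0) : z (v₀ + f (⟨d₁, hd₁⟩ + d)) = 0 := by
    obtain ⟨w, hw⟩ := hF (⟨d₁, hd₁⟩ + d)
    have e1 := LinearMap.congr_fun h₁ w
    have e2 := LinearMap.congr_fun hd w
    rw [← hw]
    simp at e1 e2 ⊢
    rw [e1, e2]
    ring
  have hbase : z (v₀ + f ⟨d₁, hd₁⟩) = 0 := by simpa using hrow 0 (by simp)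
  obtain ⟨x, hx⟩ := exists_forall_eq_row_apply z (z ∘ₗ f) (by
    intro d hd
    have := hrow d hd
    rw [map_add f, ← add_assoc, map_add z, hbase, zero_add] at this
    exact this)
  refine ⟨x, ?_, hx⟩
  have e1 := LinearMap.congr_fun h₁ x
  have e2 := hx ⟨d₁, hd₁⟩
  simp at e1 e2 hbase
  rw [e2, e1] at hbase
  linear_combination hbase

end RowFunctional

/-! ### Locality below the critical codimension -/

section AffineRangeCompatible

open Module

variable {K U V : Type*} [Field K] [AddCommGroup U] [Module K U] [AddCommGroup V] [Module K V]

theorem exists_ne_zero_ne_one_of_two_lt_card (hK : 2 < ENat.card K) : ∃ a : K, a ≠ 0 ∧ a ≠ 1 := by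
  by_contra! h
  have hsub : (Set.univ : Set K) ⊆ {0, 1} := fun a _ => by
    by_cases ha : a = 0
    · simp [ha]
    · simp [h a ha]
  have := Set.encard_le_encard hsub
  rw [Set.encard_univ] at this
  exact absurd (this.trans_eq (Set.encard_pair zero_ne_one)) (not_le.2 hK)

/-- If a nondegenerate row of an affine range-compatible map vanishes, a row `h` that does not
vanish produces a relation between the rows `z` and `h`. -/
theorem exists_row_relation [FiniteDimensional K U] {D : Submodule K (U →ₗ[K] V)}
    {s₀ : U →ₗ[K] V} {f : D →ₗ[K] V} {v₀ : V}
    (hF : ∀ d : D, v₀ + f d ∈ LinearMap.range (s₀ + (d : U →ₗ[K] V)))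
    {z h : Dual K V} {v : V} (hzv : z v = 1) (hhv : h v = 0)
    (hbad : ∀ (y : Dual K V) (u : U), u ≠ 0 → (∀ d ∈ D, y (d u) = 0) → y v = 0)
    (hz₀ : z v₀ = 0) (hz : ∀ d, z (f d) = 0)
    (hne : ¬ (h v₀ = 0 ∧ ∀ d, h (f d) = 0)) {a : K} (ha₁ : a ≠ 1) :
    ∃ x y : U, x ≠ 0 ∧ y ≠ x ∧
      (h v₀ = (z + h) (s₀ x) ∧ ∀ d : D, h (f d) = (z + h) ((d : U →ₗ[K] V) x)) ∧
      (h (s₀ (a • (y - x))) + z (s₀ (y - a • x)) = 0 ∧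
        ∀ d ∈ D, h (d (a • (y - x))) + z (d (y - a • x)) = 0) := by
  have hnd (c : K) (u : U) (hu : ∀ d ∈ D, (z + c • h) (d u) = 0) : u = 0 := by
    by_contra hu0
    have := hbad _ u hu0 hu
    simp [hzv, hhv] at this
  obtain ⟨x, hx₀, hx⟩ := exists_row_eq_of_nondegenerate hF (hnd 1)
  obtain ⟨y, hy₀, hy⟩ := exists_row_eq_of_nondegenerate hF (hnd a)
  simp only [LinearMap.add_apply, LinearMap.smul_apply, hz₀, hz, zero_add, one_smul,
    smul_eq_mul] at hx₀ hx hy₀ hy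
  have hrel₀ : h (s₀ (a • (y - x))) + z (s₀ (y - a • x)) = 0 := by
    simp only [map_smul, map_sub, smul_eq_mul]
    linear_combination a * hx₀ - hy₀
  have hrel (d : U →ₗ[K] V) (hd : d ∈ D) :
      h (d (a • (y - x))) + z (d (y - a • x)) = 0 := by
    simp only [map_smul, map_sub, smul_eq_mul]
    linear_combination a * hx ⟨d, hd⟩ - hy ⟨d, hd⟩
  have hx0 : x ≠ 0 := by
    rintro rfl
    exact hne ⟨by simpa using hx₀, fun d => by simpa using hx d⟩
  refine ⟨x, y, hx0, ?_, ⟨hx₀, hx⟩, hrel₀, hrel⟩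
  -- If y = x, the relation collapses to (1 - a) z(d y) = 0 on D.
  rintro rfl
  have h1 : (1 - a) • y = 0 := hnd 0 _ fun d hd => by
    have := hrel d hd
    simp only [sub_self, smul_zero, map_zero, zero_add, map_sub, map_smul, smul_eq_mul] at this
    simp only [zero_smul, add_zero, map_smul, smul_eq_mul]
    linear_combination this
  exact (smul_eq_zero.1 h1).elim (fun e => ha₁ (sub_eq_zero.1 e).symm) hx0

/-- An affine range-compatible map with a vanishing nondegenerate row is zero. -/
theorem eq_zero_of_row_eq_zero [FiniteDimensional K U] [FiniteDimensional K V]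
    {D : Submodule K (U →ₗ[K] V)} (hD : finrank K ((U →ₗ[K] V) ⧸ D) < finrank K V)
    {s₀ : U →ₗ[K] V} {f : D →ₗ[K] V} {v₀ : V}
    (hF : ∀ d : D, v₀ + f d ∈ LinearMap.range (s₀ + (d : U →ₗ[K] V)))
    {z : Dual K V} {v : V} (hzv : z v = 1)
    (hbad : ∀ (y : Dual K V) (u : U), u ≠ 0 → (∀ d ∈ D, y (d u) = 0) → y v = 0)
    (hz₀ : z v₀ = 0) (hz : ∀ d, z (f d) = 0) {a : K} (ha₀ : a ≠ 0) (ha₁ : a ≠ 1) :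
    v₀ = 0 ∧ ∀ d, f d = 0 := by
  let H : Submodule K (Dual K V) := LinearMap.ker (evalEquiv K V v)
  have hH (h : Dual K V) : h ∈ H ↔ h v = 0 := Iff.rfl
  let B : Submodule K (Dual K V) :=
    { carrier := {h | h v₀ = 0 ∧ ∀ d, h (f d) = 0}
      add_mem' := fun {g h} hg hh => ⟨by simp [hg.1, hh.1], fun d => by simp [hg.2 d, hh.2 d]⟩
      zero_mem' := by simp
      smul_mem' := fun c h hh => ⟨by simp [hh.1], fun d => by simp [hh.2 d]⟩ }
  have hB (h : Dual K V) : h ∈ B ↔ h v₀ = 0 ∧ ∀ d, h (f d) = 0 := Iff.rfl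
  by_cases hHB : H ≤ B
  · have hall (h : Dual K V) : h ∈ B := by
      have h1 : h - h v • z ∈ B := hHB (by simp [hH, hzv])
      simpa using B.add_mem h1 (B.smul_mem (h v) ((hB z).2 ⟨hz₀, hz⟩))
    exact ⟨(forall_dual_apply_eq_zero_iff K _).1 fun h => (hall h).1,
      fun d => (forall_dual_apply_eq_zero_iff K _).1 fun h => (hall h).2 d⟩
  exfalso
  obtain ⟨h₀, h₀H, h₀B⟩ := Set.not_subset.1 hHB
  have hh₀ : h₀ ≠ 0 := fun e => h₀B (e ▸ B.zero_mem)
  obtain ⟨b, hbs, hb₀, hspan, hb⟩ := exists_linearIndepOn_id_extension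
    ((linearIndepOn_singleton_iff K (v := (id : Dual K V → Dual K V)) (i := h₀)).2 hh₀)
    (t := {h | h ∈ H ∧ h ∉ B}) (by simpa using ⟨h₀H, h₀B⟩)
  have hb' : LinearIndependent K (fun x : b => (x : Dual K V)) := hb
  have : Fintype b := hb'.setFinite.fintype
  have hHb : H ≤ Submodule.span K b := fun h hh => by
    by_cases hhB : h ∈ B
    · have h1 : h + h₀ ∈ Submodule.span K b :=
        hspan ⟨H.add_mem hh h₀H, fun e => h₀B (by simpa using B.sub_mem e hhB)⟩
      simpa using Submodule.sub_mem _ h1 (hspan ⟨h₀H, h₀B⟩)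
    · exact hspan ⟨hh, hhB⟩
  have hcard : finrank K V ≤ Fintype.card b + 1 := by
    have h1 : finrank K H ≤ Fintype.card b := by
      refine (Submodule.finrank_mono hHb).trans (le_of_eq ?_)
      rw [← finrank_span_eq_card hb', Subtype.range_coe]
    have hv : evalEquiv K V v ≠ 0 := fun e => by
      have := LinearMap.congr_fun e z
      change z v = 0 at this
      simp [hzv] at this
    have h2 := Module.Dual.finrank_ker_add_one_of_ne_zero hv
    rw [Subspace.dual_finrank_eq] at h2
    change finrank K H + 1 = _ at h2
    omega
  choose x y hx hyx hrow hrel₀ hrel using fun h : b =>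
    exists_row_relation (h := (h : Dual K V)) hF hzv (hbs h.2).1 hbad hz₀ hz (hbs h.2).2 ha₁
  have hbv (h : b) : (h : Dual K V) v = 0 := (hbs h.2).1
  let q : b → U := fun h => a • (y h - x h)
  let p : b → U := fun h => y h - a • x h
  have hq (h : b) : q h ≠ 0 := smul_ne_zero ha₀ (sub_ne_zero.2 (hyx h))
  have hind := linearIndependent_rowForm_add hb' hzv hbv p hq
  set ε : b → Dual K (U →ₗ[K] V) := fun h => rowForm (h : Dual K V) (q h) + rowForm z (p h) with hε
  have hεD (h : b) : ε h ∈ D.dualAnnihilator :=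
    (Submodule.mem_dualAnnihilator _).2 fun d hd => hrel h d hd
  have hmax (w : Dual K (U →ₗ[K] V)) (hw : w ∈ D.dualAnnihilator) :
      w ∈ Submodule.span K (Set.range ε) := by
    by_contra hw'
    have h1 := card_le_finrank_quotient_of_linearIndependent (hind.option hw') (M := D) (by
      rintro (_ | h)
      · exact hw
      · exact hεD h)
    rw [Fintype.card_option] at h1
    omega
  by_cases hs₀ : s₀ ∈ D
  · have hf₀ : v₀ = f ⟨s₀, hs₀⟩ := by
      have := hF (-⟨s₀, hs₀⟩)
      simpa [add_neg_eq_zero] using this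
    have hlin (d : D) : f d ∈ LinearMap.range (d : U →ₗ[K] V) := by
      have := hF (d - ⟨s₀, hs₀⟩)
      simpa [hf₀] using this
    obtain ⟨x', hx'⟩ := exists_forall_eq_row_apply h₀ (h₀ ∘ₗ f) (by
      intro d hd
      obtain ⟨w, hw⟩ := hlin d
      change h₀ (f d) = 0
      rw [← hw]
      exact LinearMap.congr_fun hd w)
    let k : b := ⟨h₀, hb₀ rfl⟩
    -- h₀ ∘ F is both evaluation of row h₀ at x' and of row z + h₀ at `x k`; their difference lies
    -- in D^⊥.
    obtain ⟨c, hc⟩ := (Submodule.mem_span_range_iff_exists_fun K).1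
      (hmax (rowForm h₀ (x k - x') + rowForm z (x k))
        ((Submodule.mem_dualAnnihilator _).2 fun d hd => by
          have e1 := (hrow k).2 ⟨d, hd⟩
          have e2 := hx' ⟨d, hd⟩
          simp only [LinearMap.add_apply, LinearMap.comp_apply, rowForm_apply, map_sub] at e1 e2 ⊢
          rw [e2] at e1
          linear_combination -e1))
    classical
    obtain ⟨hp, hq'⟩ := eq_zero_of_sum_rowForm_add_eq_zero hb' hzv hbv
      (q := fun i => c i • q i - if i = k then x k - x' else 0)
      (p := ∑ i, c i • p i - x k) (by
        have hsum : ∑ i : b, rowForm (i : Dual K V) (if i = k then x k - x' else 0) =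
            rowForm h₀ (x k - x') := by
          rw [Finset.sum_eq_single k]
          · simp [k]
          · intro i _ hi
            ext s
            simp [hi]
          · simp
        have hsplit : ∑ i : b, rowForm (i : Dual K V)
              (c i • q i - if i = k then x k - x' else 0) =
            ∑ i : b, c i • rowForm (i : Dual K V) (q i) - rowForm h₀ (x k - x') := by
          rw [← hsum, ← Finset.sum_sub_distrib]
          refine Finset.sum_congr rfl fun i _ => ?_
          ext s
          simp
        have hsplit' : rowForm (K := K) (V := V) z (∑ i, c i • p i - x k) =
            ∑ i : b, c i • rowForm z (p i) - rowForm z (x k) := by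
          ext s
          simp [LinearMap.sum_apply]
        rw [hsplit, hsplit']
        simp only [hε, smul_add, Finset.sum_add_distrib] at hc
        rw [sub_add_sub_comm, hc, sub_self])
    have hcz (i : b) (hi : i ≠ k) : c i = 0 := by
      have := hq' i
      simp only [hi, if_false, sub_zero] at this
      exact (smul_eq_zero.1 this).resolve_right (hq i)
    rw [Finset.sum_eq_single k (fun i _ hi => by simp [hcz i hi]) (by simp), sub_eq_zero] at hp
    have hck : c k ≠ 0 := fun e => hx k (by rw [← hp, e, zero_smul])
    have hpk : p k = (c k)⁻¹ • x k := by rw [← hp, inv_smul_smul₀ hck]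
    have hqk : q k = (a * (a + (c k)⁻¹ - 1)) • x k := by
      have : y k = p k + a • x k := by simp [p]
      simp only [q, this, hpk]
      module
    -- Both components of `ε k` are multiples of `x k`, so it is a rank-one tensor in D^⊥.
    have := hbad ((a * (a + (c k)⁻¹ - 1)) • h₀ + (c k)⁻¹ • z) (x k) (hx k) fun d hd => by
      have e1 := hrel k d hd
      change h₀ (d (q k)) + z (d (p k)) = 0 at e1
      rw [hqk, hpk] at e1
      simpa using e1
    have h₀v : h₀ v = 0 := h₀H
    simp [h₀v, hzv, hck] at this
  -- Some form in D^⊥ is nonzero at s₀, yet the spanning forms `ε` all vanish there.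
  · obtain ⟨g, hg, hle⟩ := Submodule.exists_le_ker_of_notMem hs₀
    have hgD : g ∈ D.dualAnnihilator := (Submodule.mem_dualAnnihilator _).2 fun d hd => hle hd
    have hker : Submodule.span K (Set.range ε) ≤
        LinearMap.ker (LinearMap.applyₗ s₀ : Dual K (U →ₗ[K] V) →ₗ[K] K) := by
      rw [Submodule.span_le]
      rintro _ ⟨h, rfl⟩
      exact hrel₀ h
    exact hg (hker (hmax g hgD))

/-- An affine range-compatible map on an affine space of codimension less than `dim V` is local. -/
theorem exists_eval_of_affine_rangeCompatible (hK : 2 < ENat.card K) [FiniteDimensional K U]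
    [FiniteDimensional K V] {D : Submodule K (U →ₗ[K] V)}
    (hD : finrank K ((U →ₗ[K] V) ⧸ D) < finrank K V)
    {s₀ : U →ₗ[K] V} {f : D →ₗ[K] V} {v₀ : V}
    (hF : ∀ d : D, v₀ + f d ∈ LinearMap.range (s₀ + (d : U →ₗ[K] V))) :
    ∃ x : U, v₀ = s₀ x ∧ ∀ d : D, f d = (d : U →ₗ[K] V) x := by
  obtain ⟨a, ha₀, ha₁⟩ := exists_ne_zero_ne_one_of_two_lt_card hK
  obtain ⟨v, hv, hbad⟩ := exists_ne_zero_forall_degenerate_apply_eq_zero hD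
  obtain ⟨z, hzv⟩ : ∃ z : Dual K V, z v = 1 := by
    by_contra! h
    refine hv ((forall_dual_apply_eq_zero_iff K v).1 fun z => ?_)
    by_contra hz
    exact h ((z v)⁻¹ • z) (by simp [hz])
  obtain ⟨x, hx₀, hx⟩ := exists_row_eq_of_nondegenerate hF (z := z) fun u hu => by
    by_contra hu0
    have := hbad z u hu0 hu
    simp [hzv] at this
  obtain ⟨e₀, e⟩ := eq_zero_of_row_eq_zero hD (s₀ := s₀) (v₀ := v₀ - s₀ x)
    (f := f - LinearMap.applyₗ x ∘ₗ D.subtype) (fun d => by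
      obtain ⟨w, hw⟩ := hF d
      refine ⟨w - x, ?_⟩
      rw [map_sub, hw]
      simp
      abel) hzv hbad (by simp [hx₀]) (fun d => by simp [hx]) ha₀ ha₁
  exact ⟨x, sub_eq_zero.1 e₀, fun d => sub_eq_zero.1 (e d)⟩

theorem AffineMap.isLocalMap_of_isRangeCompatible (hK : 2 < ENat.card K) [FiniteDimensional K U]
    [FiniteDimensional K V] (S : AffineSubspace K (U →ₗ[K] V)) [Nonempty S]
    (hS : affineCodim S < finrank K V) (F : S →ᵃ[K] V)
    (hF : IsRangeCompatible (S := (S : Set (U →ₗ[K] V))) F) :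
    IsLocalMap (S := (S : Set (U →ₗ[K] V))) F := by
  obtain ⟨s₀⟩ := ‹Nonempty S›
  obtain ⟨x, hx₀, hx⟩ := exists_eval_of_affine_rangeCompatible hK hS
    (s₀ := s₀) (f := F.linear) (v₀ := F s₀) (fun d => by
      have := hF (d +ᵥ s₀)
      rw [F.map_vadd] at this
      simpa [add_comm] using this)
  refine ⟨x, fun (s : S) => ?_⟩
  have h1 := F.map_vadd s₀ (s -ᵥ s₀)
  rw [vsub_vadd, hx, hx₀] at h1
  simpa using h1

end AffineRangeCompatible

/-! ### Optimality of the bound -/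

section

open Module

variable {K U V : Type*} [Field K] [AddCommGroup U] [Module K U] [AddCommGroup V] [Module K V]

/-- Operators with a prescribed nonzero value at a nonzero vector carry a nonlocal affine
range-compatible map. -/
theorem exists_affine_rangeCompatible_not_local (hU : 2 ≤ finrank K U) (hV : 2 ≤ finrank K V) :
    ∃ (S : AffineSubspace K (U →ₗ[K] V)) (_ : Nonempty S),
      affineCodim S = finrank K V ∧
      ∃ F : S →ᵃ[K] V,
        IsRangeCompatible (S := (S : Set (U →ₗ[K] V))) F ∧
        ¬ IsLocalMap (S := (S : Set (U →ₗ[K] V))) F := by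
  have : FiniteDimensional K U := FiniteDimensional.of_finrank_pos (by omega)
  have : FiniteDimensional K V := FiniteDimensional.of_finrank_pos (by omega)
  let b := finBasis K U
  let c := finBasis K V
  let i₀ : Fin (finrank K U) := ⟨0, by omega⟩
  let i₁ : Fin (finrank K U) := ⟨1, by omega⟩
  let j₀ : Fin (finrank K V) := ⟨0, by omega⟩
  let j₁ : Fin (finrank K V) := ⟨1, by omega⟩
  have hi : i₀ ≠ i₁ := by simp [i₀, i₁]
  have hj : j₀ ≠ j₁ := by simp [j₀, j₁]
  let s₀ : U →ₗ[K] V := (b.coord i₀).smulRight (c j₀)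
  let N : Submodule K (U →ₗ[K] V) := LinearMap.ker (LinearMap.applyₗ (b i₀))
  let S : AffineSubspace K (U →ₗ[K] V) := AffineSubspace.mk' s₀ N
  have hmem (s : U →ₗ[K] V) : s ∈ S ↔ s (b i₀) = c j₀ := by
    simp [S, N, AffineSubspace.mem_mk', s₀, sub_eq_zero]
  have hne : Nonempty S := ⟨⟨s₀, AffineSubspace.self_mem_mk' _ _⟩⟩
  -- Since s (b i₀) = c j₀ on S, any scalar multiple of c j₀ is in the range of s, whatever linear
  -- scalar is chosen.
  let G : (U →ₗ[K] V) →ₗ[K] V :=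
    (LinearMap.toSpanSingleton K V (c j₀)) ∘ₗ (c.coord j₀) ∘ₗ (LinearMap.applyₗ (b i₁))
  refine ⟨S, hne, ?_, G.toAffineMap.comp S.subtype, fun s => ?_, ?_⟩
  · have hsurj : Function.Surjective (LinearMap.applyₗ (b i₀) : (U →ₗ[K] V) →ₗ[K] V) :=
      fun v => ⟨(b.coord i₀).smulRight v, by simp⟩
    unfold affineCodim
    rw [AffineSubspace.direction_mk']
    exact (LinearMap.quotKerEquivOfSurjective _ hsurj).finrank_eq
  · refine ⟨c.coord j₀ ((s : U →ₗ[K] V) (b i₁)) • b i₀, ?_⟩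
    rw [map_smul, (hmem _).1 s.2]
    rfl
  · rintro ⟨x, hx⟩
    have key (s : U →ₗ[K] V) (hs : s (b i₀) = c j₀) :
        c.coord j₀ (s (b i₁)) • c j₀ = s x := hx ⟨s, (hmem s).2 hs⟩
    -- These force in turn: coordinate i₀ of x is 0, coordinate i₁ is 1 (`h2`), coordinate i₁ is 0
    -- (`h3`).
    have h1 := key s₀ (by simp [s₀])
    have h2 := key (s₀ + (b.coord i₁).smulRight (c j₀)) (by simp [s₀, hi.symm])
    have h3 := key (s₀ + (b.coord i₁).smulRight (c j₁)) (by simp [s₀, hi.symm])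
    have hc := c.ne_zero j₀
    have hc' := c.ne_zero j₁
    simp [s₀, hi, hj] at h1 h2 h3
    rw [← h1] at h2 h3
    rw [zero_add] at h2 h3
    rw [(smul_eq_zero.1 h3.symm).resolve_right hc', zero_smul] at h2
    exact hc h2

end

theorem mainTheorem2
    {K U V : Type*} [Field K] (hK : 2 < ENat.card K)
    [AddCommGroup U] [Module K U] [FiniteDimensional K U]
    [AddCommGroup V] [Module K V] [FiniteDimensional K V] :
    (∀ (S : AffineSubspace K (U →ₗ[K] V)) [Nonempty S],
      (affineCodim S : ℤ) ≤ (Module.finrank K V : ℤ) - 1 →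
        ∀ F : S →ᵃ[K] V,
          IsRangeCompatible (S := (S : Set (U →ₗ[K] V))) F →
            IsLocalMap (S := (S : Set (U →ₗ[K] V))) F) ∧
    (2 ≤ Module.finrank K U → 2 ≤ Module.finrank K V →
      ∃ (S : AffineSubspace K (U →ₗ[K] V)) (_ : Nonempty S),
        affineCodim S = Module.finrank K V ∧
        ∃ F : S →ᵃ[K] V,
          IsRangeCompatible (S := (S : Set (U →ₗ[K] V))) F ∧
          ¬ IsLocalMap (S := (S : Set (U →ₗ[K] V))) F) := by
  refine ⟨fun S _ hS F hF => ?_, exists_affine_rangeCompatible_not_local⟩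
  exact AffineMap.isLocalMap_of_isRangeCompatible hK S (by omega) F hF
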